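/- Let $\mathbb V$ be a variety of universal algebras (finitary operations, defined by identities) with a ternary term $p$ and a binary term $\alpha$ such that the identities $$p(x,y,y)=p(y,y,x),\qquad p(x,x,x)=x,\qquad \alpha(p(x,y,y),y)=x$$ hold in $\mathbb V$. Then: 1. $\mathbb V$ is congruence modular: for every algebra $A$ in $\mathbb V$ the lattice of congruences of $A$ is modular. 2. For every split epimorphism $f:X\to Y$ in $\mathbb V$ with chosen section $s:Y\to X$ (that is, for every object of the fibre $Pt_Y\mathbb V$) and every $y\in Y$, the set $f^{-1}(y)$, pointed by $0=s(y)$, is closed under the operations $u\circ v=p(u,s(y),v)$ and $\upsilon(u)=\alpha(u,s(y))$, and with them it is a $\mathrm{Hex}$-algebra: $u\circ 0=0\circ u$ and $\upsilon(u\circ 0)=u$, with $0\circ 0=0$ and $\upsilon(0)=0$. 3. For every $Y$ in $\mathbb V$, the fibre $Pt_Y\mathbb V$ (the category of split epimorphisms onto $Y$ with a chosen section) is congruence hyperextensible. Here a finitely complete pointed category is called congruence hyperextensible if for all morphisms $f:W\to X$ and $g:W\to Z$ with sections $s$ of $f$ and $t$ of $g$ such that $gs=0$ and $ft=0$, and every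 equivalence relation $T$ on $W$ with $R[f]\cap R[g]\subset T$, one has $R[f]\cap g^{-1}(t^{-1}(T))\subset T$, where $R[f]$ denotes the kernel equivalence relation of $f$. 4. $\mathbb V$ is a Gumm category, i.e. it is finitely complete and satisfies the Shifting Lemma: for all equivalence relations $T,S,R$ on an object with $R\cap S\subset T$, if $x\,S\,y$, $x'\,S\,y'$, $x\,R\,x'$, $y\,R\,y'$ and $x\,T\,x'$, then $y\,T\,y'$ (for generalized elements). -/

import Mathlib

open CategoryTheory CategoryTheory.Limits

universe u u' w v₁ u₁

namespace GummVar

/-! ### Varieties of universal algebras -/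

/-- A variety over an algebraic (relation-free) language `L`, presented by a set of identities
between terms in countably many variables. -/
structure Variety (L : FirstOrder.Language.{u, u'}) where
  identities : Set (L.Term ℕ × L.Term ℕ)

namespace Variety

variable {L : FirstOrder.Language.{u, u'}}

/-- The algebra `A` satisfies all the identities of the variety. -/
def Models (V : Variety L) (A : Type w) [L.Structure A] : Prop :=
  ∀ e ∈ V.identities, ∀ x : ℕ → A, e.1.realize x = e.2.realize x

/-- The algebras of the variety with underlying set in `Type w`. -/
structure Alg (V : Variety L) where
  carrier : Type w
  [str : L.Structure carrier]
  models : V.Models carrier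

instance (V : Variety L) : CoeSort V.Alg (Type w) := ⟨Alg.carrier⟩

instance (V : Variety L) (A : V.Alg) : L.Structure A := A.str

/-- The category of algebras of the variety and homomorphisms. -/
instance (V : Variety L) : Category V.Alg where
  Hom A B := L.Hom A B
  id A := FirstOrder.Language.Hom.id L A
  comp f g := FirstOrder.Language.Hom.comp g f

end Variety

/-! ### Congruences -/

/-- A congruence on an `L`-algebra: an equivalence relation compatible with every operation. -/
structure Congruence (L : FirstOrder.Language.{u, u'}) (A : Type w) [L.Structure A] extends Setoid A where
  compat : ∀ {n : ℕ} (F : L.Functions n) (x y : Fin n → A), (∀ i, toSetoid.r (x i) (y i)) →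
    toSetoid.r (FirstOrder.Language.Structure.funMap F x) (FirstOrder.Language.Structure.funMap F y)

namespace Congruence

variable {L : FirstOrder.Language.{u, u'}} {A : Type w} [L.Structure A]

theorem toSetoid_injective :
    Function.Injective (toSetoid : Congruence L A → Setoid A) := by
  rintro ⟨r, _⟩ ⟨s, _⟩ h
  cases h
  rfl

/-- Congruences are ordered by inclusion. -/
instance : PartialOrder (Congruence L A) := PartialOrder.lift toSetoid toSetoid_injective

/-- The intersection of a family of congruences. -/
instance : InfSet (Congruence L A) where
  sInf S :=
    { toSetoid := sInf (toSetoid '' S)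
      compat := by
        rintro n F x y h _ ⟨c, hc, rfl⟩
        exact c.compat F x y fun i => h i _ ⟨c, hc, rfl⟩ }

/-- The lattice of congruences: the meet is the intersection, and the join is the smallest
congruence containing both. -/
instance : CompleteLattice (Congruence L A) :=
  completeLatticeOfInf _ fun S =>
    ⟨fun c hc _ _ h => h _ ⟨c, hc, rfl⟩,
     fun _ hd _ _ h => by
      rintro _ ⟨c, hc, rfl⟩
      exact hd hc h⟩

end Congruence

/-- A variety is congruence modular when the congruence lattice of each of its algebras is
modular. -/
def Variety.IsCongruenceModular {L : FirstOrder.Language.{u, u'}} (V : Variety L) : Prop :=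
  ∀ A : Variety.Alg.{u, u', w} V, IsModularLattice (Congruence L A)

/-! ### Internal equivalence relations, Gumm categories, congruence hyperextensible categories -/

section Categorical

variable {C : Type u₁} [Category.{v₁} C]

/-- An equivalence relation on the object `X`, represented by its two legs. -/
structure InternalEquiv (X : C) where
  obj : C
  d₀ : obj ⟶ X
  d₁ : obj ⟶ X
  isEquivalenceRelation : IsEquivalenceRelation d₀ d₁

/-- The generalized elements `x` and `y` of `X` are related by `T`. -/
def InternalEquiv.Rel {X : C} (T : InternalEquiv X) {U : C} (x y : U ⟶ X) : Prop :=
  ∃ h : U ⟶ T.obj, h ≫ T.d₀ = x ∧ h ≫ T.d₁ = y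

variable (C) in
/-- A Gumm category: a finitely complete category in which the Shifting Lemma holds. For
equivalence relations `T`, `S`, `R` on `X` with `R ∩ S ⊆ T`, if `x S y`, `x' S y'`, `x R x'`,
`y R y'` and `x T x'`, then `y T y'` (on generalized elements). -/
structure IsGummCategory : Prop where
  hasFiniteLimits : HasFiniteLimits C
  shifting : ∀ {X : C} (T S R : InternalEquiv X),
    (∀ {U : C} (a b : U ⟶ X), R.Rel a b → S.Rel a b → T.Rel a b) →
    ∀ {U : C} (x y x' y' : U ⟶ X), S.Rel x y → S.Rel x' y' → R.Rel x x' → R.Rel y y' →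
      T.Rel x x' → T.Rel y y'

/-- In a pointed category: a zero morphism is one which factors through a zero object. -/
def IsZeroMor {X Y : C} (f : X ⟶ Y) : Prop :=
  ∃ (O : C) (_ : IsZero O) (a : X ⟶ O) (b : O ⟶ Y), f = a ≫ b

/-- The span `(f, g)` is punctual with respect to the sections `s` of `f` and `t` of `g`. -/
structure IsPunctualSpan {W X Z : C} (f : W ⟶ X) (g : W ⟶ Z) (s : X ⟶ W) (t : Z ⟶ W) : Prop where
  section_left : s ≫ f = 𝟙 X
  section_right : t ≫ g = 𝟙 Z
  left_punctual : IsZeroMor (s ≫ g)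
  right_punctual : IsZeroMor (t ≫ f)

variable (C) in
/-- A congruence hyperextensible category: a finitely complete pointed category such that, for
any punctual span `(f, g)` on `W` with sections `(s, t)` and any equivalence relation `T` on `W`,
`R[f] ∩ R[g] ⊆ T` implies `R[f] ∩ g⁻¹(t⁻¹(T)) ⊆ T`. Here `R[f]` is the kernel equivalence relation
of `f`: the generalized elements `x`, `x'` are related by it when `x ≫ f = x' ≫ f`. -/
structure IsCongruenceHyperextensible : Prop where
  hasFiniteLimits : HasFiniteLimits C
  hasZeroObject : HasZeroObject C
  hyperextensible : ∀ {W X Z : C} (f : W ⟶ X) (g : W ⟶ Z) (s : X ⟶ W) (t : Z ⟶ W),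
    IsPunctualSpan f g s t → ∀ T : InternalEquiv W,
    (∀ {U : C} (x x' : U ⟶ W), x ≫ f = x' ≫ f → x ≫ g = x' ≫ g → T.Rel x x') →
    ∀ {U : C} (x x' : U ⟶ W), x ≫ f = x' ≫ f →
      T.Rel (x ≫ g ≫ t) (x' ≫ g ≫ t) → T.Rel x x'

/-- The fibre above `Y` of the fibration of points: split epimorphisms onto `Y` with a chosen
section, i.e. the coslice under `1_Y` of the slice category over `Y`. -/
abbrev Pt (Y : C) := Under (Over.mk (𝟙 Y))

end Categorical

/-- A `Hex`-algebra: a pointed set with a binary operation `circ` and a unary operation `upsilon`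
such that `a ∘ 0 = 0 ∘ a` and `υ (a ∘ 0) = a`. As the variety is pointed, `0` is its only constant:
`{0}` is a subalgebra. -/
structure HexAlgebra (H : Type w) where
  zero : H
  circ : H → H → H
  upsilon : H → H
  circ_zero_zero : circ zero zero = zero
  upsilon_zero : upsilon zero = zero
  circ_comm_zero : ∀ a, circ a zero = circ zero a
  upsilon_circ_zero : ∀ a, upsilon (circ a zero) = a

end GummVar

namespace GummVar

/-! ### The Shifting Lemma for compatible relations -/

section Compatible

variable {L : FirstOrder.Language.{u, u'}} {A : Type w} [L.Structure A]

/-! Everything but the Hex-algebras follows from one shift. Given `x T x'`, put `z =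
α(p(y,x,x'),x)`. Replacing `x'` by `x` turns `z` into `α(p(y,x,x),x) = y`, so any congruence
relating `x` and `x'` relates `y` and `z`. Moving `y` to `x` and `x'` to `y'` along `S` turns `z`
into `α(p(x,x,y'),x) = y'`. Hence `z` is both `R`- and `S`-related to `y'`, so `y T z T y'`.

`S` need only be reflexive and compatible (`shifting_of_terms`). Modularity uses this with `S` a
finite alternating composite of two congruences. The categorical statements follow by reading
internal relations on underlying sets (`InternalEquiv.rel_of_elemRel`), hyperextensibility being the
shift with `S = R[g]`. -/

variable (L) in
/-- A binary relation compatible with every operation. -/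
def Compatible (r : A → A → Prop) : Prop :=
  ∀ {n : ℕ} (F : L.Functions n) (x y : Fin n → A), (∀ i, r (x i) (y i)) →
    r (FirstOrder.Language.Structure.funMap F x) (FirstOrder.Language.Structure.funMap F y)

theorem Compatible.realize {r : A → A → Prop} (hr : Compatible L r) {β : Type*} (t : L.Term β)
    {x y : β → A} (h : ∀ i, r (x i) (y i)) : r (t.realize x) (t.realize y) := by
  induction t with
  | var i => exact h i
  | func F ts ih => exact hr F _ _ ih

theorem Compatible.realize₂ {r : A → A → Prop} (hr : Compatible L r) (t : L.Term (Fin 2))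
    {a b a' b' : A} (ha : r a a') (hb : r b b') : r (t.realize ![a, b]) (t.realize ![a', b']) :=
  hr.realize t fun i => by fin_cases i <;> assumption

theorem Compatible.realize₃ {r : A → A → Prop} (hr : Compatible L r) (t : L.Term (Fin 3))
    {a b c a' b' c' : A} (ha : r a a') (hb : r b b') (hc : r c c') :
    r (t.realize ![a, b, c]) (t.realize ![a', b', c']) :=
  hr.realize t fun i => by fin_cases i <;> assumption

/-- The Shifting Lemma, for two congruences `R` and `T` and a compatible reflexive
relation `S`. -/
theorem shifting_of_terms (p : L.Term (Fin 3)) (α : L.Term (Fin 2))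
    (hp : ∀ x y : A, p.realize ![x, y, y] = p.realize ![y, y, x])
    (hα : ∀ x y : A, α.realize ![p.realize ![x, y, y], y] = x)
    {R S T : A → A → Prop} (hR : Equivalence R) (hT : Equivalence T) (hS : ∀ a, S a a)
    (cR : Compatible L R) (cS : Compatible L S) (cT : Compatible L T)
    (h : ∀ a b, R a b → S a b → T a b) {x y x' y' : A} (hyx : S y x) (hxy' : S x' y')
    (hRx : R x x') (hRy : R y y') (hTx : T x x') : T y y' := by
  -- Stated for a general `Q` because it is needed for both `T` and `R`.
  have key : ∀ {Q : A → A → Prop}, Equivalence Q → Compatible L Q → Q x x' →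
      Q y (α.realize ![p.realize ![y, x, x'], x]) := fun {Q} eQ cQ hQ => by
    have := cQ.realize₂ α (cQ.realize₃ p (eQ.refl y) (eQ.refl x) hQ) (eQ.refl x)
    rwa [hα] at this
  have hS' : S (α.realize ![p.realize ![y, x, x'], x]) y' := by
    have := cS.realize₂ α (cS.realize₃ p hyx (hS x) hxy') (hS x)
    rwa [← hp, hα] at this
  exact hT.trans (key hT cT hTx) (h _ _ (hR.trans (hR.symm (key hR cR hRx)) hRy) hS')

end Compatible

/-! ### Congruence modularity -/

namespace Congruence

variable {L : FirstOrder.Language.{u, u'}} {A : Type w} [L.Structure A]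

theorem compatible (c : Congruence L A) : Compatible L c.r := c.compat

/-- The relations `b`, `b ∘ a ∘ b`, `b ∘ a ∘ b ∘ a ∘ b ∘ a ∘ b`, … whose union is the join of
`a` and `b`. -/
def chain (a b : Congruence L A) : ℕ → A → A → Prop
  | 0 => b.r
  | n + 1 => fun x y => ∃ u v, chain a b n x u ∧ a.r u v ∧ chain a b n v y

variable (a b : Congruence L A)

theorem chain_refl (n : ℕ) (x : A) : chain a b n x x := by
  induction n with
  | zero => exact b.iseqv.refl x
  | succ n ih => exact ⟨x, x, ih, a.iseqv.refl x, ih⟩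

theorem chain_symm (n : ℕ) {x y : A} (h : chain a b n x y) : chain a b n y x := by
  induction n generalizing x y with
  | zero => exact b.iseqv.symm h
  | succ n ih =>
    obtain ⟨u, v, h₁, h₂, h₃⟩ := h
    exact ⟨v, u, ih h₃, a.iseqv.symm h₂, ih h₁⟩

theorem chain_compatible (n : ℕ) : Compatible L (chain a b n) := by
  induction n with
  | zero => exact b.compat
  | succ n ih =>
    intro k F x y h
    choose u v h₁ h₂ h₃ using h
    exact ⟨_, _, ih F x u h₁, a.compat F u v h₂, ih F v y h₃⟩

theorem chain_mono {m n : ℕ} (hmn : m ≤ n) {x y : A} (h : chain a b m x y) :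
    chain a b n x y := by
  induction n, hmn using Nat.le_induction with
  | base => exact h
  | succ n _ ih => exact ⟨y, y, ih, a.iseqv.refl y, chain_refl a b n y⟩

/-- The union of the relations `chain a b n`, as a congruence. -/
def chainSup : Congruence L A where
  r x y := ∃ n, chain a b n x y
  iseqv :=
    { refl := fun x => ⟨0, chain_refl a b 0 x⟩
      symm := fun ⟨n, h⟩ => ⟨n, chain_symm a b n h⟩
      trans := fun {_ y _} ⟨m, h⟩ ⟨n, h'⟩ =>
        -- One more level glues two chains, with a trivial `a`-step in the middle.
        ⟨max m n + 1, y, y, chain_mono a b (le_max_left m n) h, a.iseqv.refl y,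
          chain_mono a b (le_max_right m n) h'⟩ }
  compat := by
    intro k F x y h
    choose n hn using h
    -- Operations are finitary, so one level serves all arguments.
    exact ⟨Finset.univ.sup n, chain_compatible a b _ F x y fun i =>
      chain_mono a b (Finset.le_sup (Finset.mem_univ i)) (hn i)⟩

theorem sup_le_chainSup : a ⊔ b ≤ chainSup a b :=
  sup_le (fun x y h => ⟨1, x, y, chain_refl a b 0 x, h, chain_refl a b 0 y⟩)
    fun _ _ h => ⟨0, h⟩

theorem inf_r {c : Congruence L A} {x y : A} (hb : b.r x y) (hc : c.r x y) : (b ⊓ c).r x y := by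
  let d : Congruence L A :=
    { r := fun x y => b.r x y ∧ c.r x y
      iseqv :=
        { refl := fun x => ⟨b.iseqv.refl x, c.iseqv.refl x⟩
          symm := fun h => ⟨b.iseqv.symm h.1, c.iseqv.symm h.2⟩
          trans := fun h h' => ⟨b.iseqv.trans h.1 h'.1, c.iseqv.trans h.2 h'.2⟩ }
      compat := fun F x y h =>
        ⟨b.compat F x y fun i => (h i).1, c.compat F x y fun i => (h i).2⟩ }
  have : d ≤ b ⊓ c := le_inf (fun _ _ h => h.1) fun _ _ h => h.2
  exact this ⟨hb, hc⟩

/-- Induction on the chain level: with `a ≤ c`, the middle `a`-step lies in both `c` and `a ⊔ b ⊓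
c`, and the outer chains play the role of `S`. These need not be transitive. -/
theorem isModularLattice_of_terms (p : L.Term (Fin 3)) (α : L.Term (Fin 2))
    (hp : ∀ x y : A, p.realize ![x, y, y] = p.realize ![y, y, x])
    (hα : ∀ x y : A, α.realize ![p.realize ![x, y, y], y] = x) :
    IsModularLattice (Congruence L A) where
  sup_inf_le_assoc_of_le {a} b {c} hac := by
    have key : ∀ n x y, c.r x y → chain a b n x y → (a ⊔ b ⊓ c).r x y := by
      intro n
      induction n with
      | zero =>
        intro x y hc hb
        exact (le_sup_right : b ⊓ c ≤ a ⊔ b ⊓ c) (inf_r b hb hc)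
      | succ n ih =>
        rintro x y hc ⟨u, v, h₁, h₂, h₃⟩
        exact shifting_of_terms p α hp hα c.iseqv (a ⊔ b ⊓ c).iseqv (chain_refl a b n)
          c.compatible (chain_compatible a b n) (compatible _) ih h₁ h₃ (hac h₂) hc
          ((le_sup_left : a ≤ a ⊔ b ⊓ c) h₂)
    intro x y h
    obtain ⟨n, hn⟩ := sup_le_chainSup a b ((inf_le_left : (a ⊔ b) ⊓ c ≤ _) h)
    exact key n x y ((inf_le_right : (a ⊔ b) ⊓ c ≤ _) h) hn

end Congruence

/-! ### Internal equivalence relations on elements -/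

section Elements

variable {C : Type u₁} [Category.{v₁} C] (F : C ⥤ Type w)

/-- The relation induced by `T` on the set `F.obj X` of elements of `X`. -/
def InternalEquiv.ElemRel {X : C} (T : InternalEquiv X) (a b : F.obj X) : Prop :=
  ∃ k : F.obj T.obj, F.map T.d₀ k = a ∧ F.map T.d₁ k = b

theorem InternalEquiv.Rel.elemRel {X : C} {T : InternalEquiv X} {U : C} {x y : U ⟶ X}
    (h : T.Rel x y) (k : F.obj U) : T.ElemRel F (F.map x k) (F.map y k) := by
  obtain ⟨h, rfl, rfl⟩ := h
  exact ⟨F.map h k, by simp, by simp⟩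

variable [PreservesLimitsOfShape WalkingCospan F]

theorem InternalEquiv.elemRel_equivalence {X : C} (T : InternalEquiv X) :
    Equivalence (T.ElemRel F) := by
  obtain ⟨⟨e⟩⟩ := T.isEquivalenceRelation
  refine ⟨fun a => ⟨F.map e.r a, ?_, ?_⟩, ?_, ?_⟩
  · rw [← Functor.map_comp_apply, e.reflexivity₁, Functor.map_id_apply]
  · rw [← Functor.map_comp_apply, e.reflexivity₂, Functor.map_id_apply]
  · rintro _ _ ⟨k, rfl, rfl⟩
    refine ⟨F.map e.s k, ?_, ?_⟩
    · rw [← Functor.map_comp_apply, e.symmetry₁]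
    · rw [← Functor.map_comp_apply, e.symmetry₂]
  · rintro _ _ _ ⟨k, rfl, rfl⟩ ⟨l, hl, rfl⟩
    obtain ⟨m, rfl, rfl⟩ := Types.exists_of_isPullback
      ((IsPullback.mk ⟨e.c.condition⟩ ⟨e.isLimit.ofIsoLimit e.c.eta⟩).map F) k l hl.symm
    refine ⟨F.map e.t m, ?_, ?_⟩
    · rw [← Functor.map_comp_apply, e.transitivity₁, Functor.map_comp_apply]
    · rw [← Functor.map_comp_apply, e.transitivity₂, Functor.map_comp_apply]

variable [PreservesLimitsOfShape WalkingParallelPair F] [HasPullbacks C] [HasEqualizers C]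

/-- The joint pullback of two spans, on elements. -/
theorem exists_joint_pullback {A B X Z : C} (c : A ⟶ X) (c' : A ⟶ Z) (d : B ⟶ X) (d' : B ⟶ Z) :
    ∃ (P : C) (p : P ⟶ A) (q : P ⟶ B), p ≫ c = q ≫ d ∧ p ≫ c' = q ≫ d' ∧
      (∀ a b, F.map c a = F.map d b → F.map c' a = F.map d' b →
        ∃ k, F.map p k = a ∧ F.map q k = b) ∧
      ∀ k l, F.map p k = F.map p l → F.map q k = F.map q l → k = l := by
  have hE := isLimitForkMapOfIsLimit F (equalizer.condition _ _)
    (equalizerIsEqualizer (pullback.fst c d ≫ c') (pullback.snd c d ≫ d'))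
  have hP := (IsPullback.of_hasPullback c d).map F
  have hm : Mono (F.map (equalizer.ι (pullback.fst c d ≫ c') (pullback.snd c d ≫ d'))) :=
    mono_of_isLimit_fork hE
  refine ⟨equalizer (pullback.fst c d ≫ c') (pullback.snd c d ≫ d'),
    equalizer.ι _ _ ≫ pullback.fst c d, equalizer.ι _ _ ≫ pullback.snd c d,
    by simp [pullback.condition], by simpa using equalizer.condition (pullback.fst c d ≫ c') (pullback.snd c d ≫ d'), ?_, ?_⟩
  · intro a b h h'
    obtain ⟨m, rfl, rfl⟩ := Types.exists_of_isPullback hP a b h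
    obtain ⟨k, rfl, -⟩ := Types.unique_of_type_equalizer _ _ hE m (by simpa using h')
    exact ⟨k, by simp, by simp⟩
  · intro k l h h'
    simp only [Functor.map_comp_apply] at h h'
    exact (mono_iff_injective _).1 hm (Types.ext_of_isPullback hP h h')

theorem InternalEquiv.elem_ext {X : C} (T : InternalEquiv X) {k l : F.obj T.obj}
    (h₀ : F.map T.d₀ k = F.map T.d₀ l) (h₁ : F.map T.d₁ k = F.map T.d₁ l) : k = l := by
  obtain ⟨⟨e⟩⟩ := T.isEquivalenceRelation
  obtain ⟨P, p, q, hp, hq, hex, -⟩ := exists_joint_pullback F T.d₀ T.d₁ T.d₀ T.d₁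
  obtain ⟨m, rfl, rfl⟩ := hex k l h₀ h₁
  rw [e.right_cancellation p q hp hq]

/-- Pull `(d₀, d₁)` back along `(x, y)`. The projection to `U` is bijective on elements: onto by
hypothesis, injective by joint monicity of the legs. It is therefore invertible, and its inverse
yields the factorization. -/
theorem InternalEquiv.rel_of_elemRel [F.ReflectsIsomorphisms] {X : C} (T : InternalEquiv X)
    {U : C} {x y : U ⟶ X} (h : ∀ k, T.ElemRel F (F.map x k) (F.map y k)) : T.Rel x y := by
  obtain ⟨P, p, q, hp, hq, hex, huniq⟩ := exists_joint_pullback F x y T.d₀ T.d₁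
  have : IsIso (F.map p) := by
    rw [isIso_iff_bijective]
    refine ⟨fun k l hkl => huniq k l hkl (T.elem_ext F ?_ ?_), fun u => ?_⟩
    · simp only [← Functor.map_comp_apply, ← hp]
      simp [hkl]
    · simp only [← Functor.map_comp_apply, ← hq]
      simp [hkl]
    · obtain ⟨t, h₀, h₁⟩ := h u
      obtain ⟨k, hk, -⟩ := hex u t h₀.symm h₁.symm
      exact ⟨k, hk⟩
  have : IsIso p := isIso_of_reflects_iso p F
  exact ⟨inv p ≫ q, by simp [← hp], by simp [← hq]⟩

end Elements

/-! ### Limits of algebras -/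

namespace Variety

variable {L : FirstOrder.Language.{u, u'}} (V : Variety L)

instance {A B : Alg.{u, u', w} V} : FunLike (A ⟶ B) A B :=
  inferInstanceAs (FunLike (L.Hom A B) A B)

/-- The underlying set functor. -/
def underlying : Alg.{u, u', w} V ⥤ Type w where
  obj A := A
  map f := TypeCat.ofHom f

variable {V}

@[ext]
theorem hom_ext {A B : Alg.{u, u', w} V} {f g : A ⟶ B} (h : ∀ x, f x = g x) : f = g :=
  DFunLike.ext f g h

theorem map_funMap {A B : Alg.{u, u', w} V} (f : A ⟶ B) {n : ℕ} (F : L.Functions n)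
    (x : Fin n → A) : f (FirstOrder.Language.Structure.funMap F x) =
      FirstOrder.Language.Structure.funMap F (f ∘ x) :=
  FirstOrder.Language.Hom.map_fun f F x

/-- A map of algebras compatible with the operations is a homomorphism. -/
def homMk [L.IsAlgebraic] {A B : Alg.{u, u', w} V} (f : A → B)
    (hf : ∀ {n : ℕ} (F : L.Functions n) (x : Fin n → A),
      f (FirstOrder.Language.Structure.funMap F x) =
        FirstOrder.Language.Structure.funMap F (f ∘ x)) : A ⟶ B :=
  show L.Hom A B from
    { toFun := f
      map_fun' := hf
      map_rel' := fun r => isEmptyElim r }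

theorem compatible_range {K A : Alg.{u, u', w} V} (d₀ d₁ : K ⟶ A) :
    Compatible L fun a b => ∃ k, d₀ k = a ∧ d₁ k = b := by
  intro n F x y h
  choose k h₀ h₁ using h
  exact ⟨FirstOrder.Language.Structure.funMap F k,
    (map_funMap d₀ F k).trans (congrArg _ (funext h₀)),
    (map_funMap d₁ F k).trans (congrArg _ (funext h₁))⟩

theorem compatible_ker {A B : Alg.{u, u', w} V} (f : A ⟶ B) :
    Compatible L fun a b => f a = f b := fun F x y h => by
  change f _ = f _
  rw [map_funMap, map_funMap]
  exact congrArg _ (funext h)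

/-! ### The fibres of the fibration of points -/

section Fibre

variable (Y : Alg.{u, u', w} V)

variable (V) in
/-- The underlying set functor of the fibre above `Y`. -/
def ptUnderlying : Pt Y ⥤ Type w := Under.forget _ ⋙ Over.forget Y ⋙ V.underlying

variable {Y}

/-- The map from an object of the fibre above `Y` to the zero object. -/
def ptToZero (A : Pt Y) : A ⟶ Under.mk (𝟙 (Over.mk (𝟙 Y))) :=
  Under.homMk (Over.homMk A.right.hom) (Over.mkIdTerminal.hom_ext _ _)

theorem ptToZero_unique {A : Pt Y} (f g : A ⟶ Under.mk (𝟙 (Over.mk (𝟙 Y)))) : f = g :=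
  Under.UnderMorphism.ext (Over.mkIdTerminal.hom_ext _ _)

variable (Y) in
theorem isZero_pt : IsZero (Under.mk (𝟙 (Over.mk (𝟙 Y))) : Pt Y) where
  unique_to B := ⟨⟨⟨Under.mkIdInitial.to B⟩, fun _ => Under.mkIdInitial.hom_ext _ _⟩⟩
  unique_from B := ⟨⟨⟨ptToZero B⟩, fun _ => ptToZero_unique _ _⟩⟩

/-- The projection to `Y`, on elements. -/
def ptProj (A : Pt Y) (a : (ptUnderlying V Y).obj A) : Y := A.right.hom a

theorem ptProj_map {A B : Pt Y} (f : A ⟶ B) (a : (ptUnderlying V Y).obj A) :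
    ptProj B ((ptUnderlying V Y).map f a) = ptProj A a :=
  DFunLike.congr_fun (Over.w f.right) a

/-- The zero object of the fibre is `Y` itself, so a zero morphism depends only on the projection to
`Y`. -/
theorem map_eq_of_isZeroMor {A B : Pt Y} {f : A ⟶ B} (hf : IsZeroMor f)
    {a b : (ptUnderlying V Y).obj A} (h : ptProj A a = ptProj A b) :
    (ptUnderlying V Y).map f a = (ptUnderlying V Y).map f b := by
  obtain ⟨O, hO, i, j, rfl⟩ := hf
  have : i ≫ j = ptToZero A ≫ (isZero_pt Y).to_ B := by
    rw [hO.eq_of_src j (ptToZero O ≫ (isZero_pt Y).to_ B), ← Category.assoc]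
    exact congrArg (· ≫ _) (ptToZero_unique _ _)
  rw [this, Functor.map_comp_apply, Functor.map_comp_apply]
  exact congrArg _ h

end Fibre

variable [L.IsAlgebraic]

instance : (underlying.{u, u', w} V).ReflectsIsomorphisms where
  reflects {A B} f hf := by
    have hb : Function.Bijective f := (isIso_iff_bijective _).1 hf
    let e := Equiv.ofBijective f hb
    have he : ∀ x, f (e.symm x) = x := e.apply_symm_apply
    refine ⟨homMk e.symm fun F x => ?_, hom_ext e.symm_apply_apply, hom_ext he⟩
    rw [Equiv.symm_apply_eq]
    change _ = f _
    rw [map_funMap]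
    exact congrArg _ (funext fun i => (he _).symm)

section Limits

variable {J : Type w} [SmallCategory J] (G : J ⥤ Alg.{u, u', w} V)

instance : L.Structure (G ⋙ V.underlying).sections where
  funMap F x := ⟨fun j => FirstOrder.Language.Structure.funMap (M := G.obj j) F
    fun i => (x i).1 j, fun {j j'} f => by
      refine (map_funMap (G.map f) F _).trans ?_
      exact congrArg _ (funext fun i => (x i).2 f)⟩
  RelMap r := isEmptyElim r

/-- The projections from the set of sections are homomorphisms. -/
def sectionsProj (j : J) : L.Hom (G ⋙ V.underlying).sections (G.obj j) where
  toFun x := x.1 j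
  map_fun' _ _ := rfl
  map_rel' r := isEmptyElim r

/-- The limit of a diagram of algebras. -/
def limitAlg : Alg.{u, u', w} V where
  carrier := (G ⋙ V.underlying).sections
  models e he x := by
    refine Subtype.ext (funext fun j => ?_)
    have h (t : L.Term ℕ) : (t.realize x).1 j = t.realize (sectionsProj G j ∘ x) :=
      (FirstOrder.Language.HomClass.realize_term (sectionsProj G j)).symm
    rw [h, h]
    exact (G.obj j).models e he _

/-- The limit cone of a diagram of algebras. -/
def limitCone : Cone G where
  pt := limitAlg G
  π :=
    { app := fun j => sectionsProj G j
      naturality := fun _ _ f => hom_ext fun x => (x.2 f).symm }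

/-- The cone `limitCone G` is a limit. -/
def limitConeIsLimit : IsLimit (limitCone G) where
  lift s := homMk (fun a => ⟨fun j => s.π.app j a, fun f => by
    exact DFunLike.congr_fun (s.w f) a⟩)
    fun F x => Subtype.ext (funext fun j => map_funMap (s.π.app j) F x)
  fac _ _ := rfl
  uniq s m h := hom_ext fun a => Subtype.ext (funext fun j => by
    exact DFunLike.congr_fun (h j) a)

instance : HasLimitsOfSize.{w, w} (Alg.{u, u', w} V) :=
  ⟨fun _ _ => ⟨fun G => ⟨⟨limitCone G, limitConeIsLimit G⟩⟩⟩⟩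

instance : PreservesLimitsOfSize.{w, w} (underlying.{u, u', w} V) where
  preservesLimitsOfShape := ⟨fun {G} =>
    preservesLimit_of_preserves_limit_cone (limitConeIsLimit G) <| Classical.choice <|
      (Types.isLimit_iff _).2 fun s hs =>
        ⟨(⟨s, hs⟩ : (G ⋙ V.underlying).sections), fun _ => rfl, fun _ h =>
          Subtype.ext (funext h)⟩⟩

instance : HasFiniteLimits (Alg.{u, u', w} V) :=
  hasFiniteLimits_of_hasLimitsOfSize.{w, w} _

instance : PreservesFiniteLimits (underlying.{u, u', w} V) :=
  PreservesLimitsOfSize.preservesFiniteLimits.{w, w} _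

end Limits

/-! ### Gumm categories and congruence hyperextensible fibres -/

variable (p : L.Term (Fin 3)) (α : L.Term (Fin 2))

theorem isGummCategory_of_terms
    (hp : ∀ (A : Alg.{u, u', w} V) (x y : A), p.realize ![x, y, y] = p.realize ![y, y, x])
    (hα : ∀ (A : Alg.{u, u', w} V) (x y : A), α.realize ![p.realize ![x, y, y], y] = x) :
    IsGummCategory (Alg.{u, u', w} V) where
  hasFiniteLimits := inferInstance
  shifting := by
    intro X T S R h U x y x' y' hxy hxy' hRx hRy hTx
    refine T.rel_of_elemRel V.underlying fun k => ?_
    have eS := S.elemRel_equivalence V.underlying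
    refine shifting_of_terms (A := X) p α (hp X) (hα X)
      (R.elemRel_equivalence V.underlying) (T.elemRel_equivalence V.underlying) eS.refl
      (compatible_range R.d₀ R.d₁) (compatible_range S.d₀ S.d₁) (compatible_range T.d₀ T.d₁)
      ?_ (eS.symm (hxy.elemRel _ k)) (hxy'.elemRel _ k) (hRx.elemRel _ k) (hRy.elemRel _ k)
      (hTx.elemRel _ k)
    rintro _ _ ⟨r, rfl, rfl⟩ ⟨s, h₀, h₁⟩
    -- The hypothesis concerns generalized elements; apply it to the universal pair on the object `R
    -- ∩ S`, then evaluate.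
    obtain ⟨P, q, q', hq, hq', hex, -⟩ :=
      exists_joint_pullback V.underlying R.d₀ R.d₁ S.d₀ S.d₁
    obtain ⟨m, rfl, rfl⟩ := hex r s h₀.symm h₁.symm
    have := (h (q ≫ R.d₀) (q ≫ R.d₁) ⟨q, rfl, rfl⟩ ⟨q', hq.symm, hq'.symm⟩).elemRel
      V.underlying m
    rwa [Functor.map_comp_apply, Functor.map_comp_apply] at this

section Fibre

variable (Y : Alg.{u, u', w} V)

instance : (ptUnderlying V Y).ReflectsIsomorphisms := by
  unfold ptUnderlying; infer_instance

/-- Pullbacks and equalizers have connected shapes, which forgetting the base `Y` preserves; it need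
not preserve products. -/
instance : PreservesLimitsOfShape WalkingCospan (ptUnderlying V Y) := by
  unfold ptUnderlying; infer_instance

instance : PreservesLimitsOfShape WalkingParallelPair (ptUnderlying V Y) := by
  unfold ptUnderlying; infer_instance

variable {Y}

theorem isCongruenceHyperextensible_of_terms
    (hp : ∀ (A : Alg.{u, u', w} V) (x y : A), p.realize ![x, y, y] = p.realize ![y, y, x])
    (hα : ∀ (A : Alg.{u, u', w} V) (x y : A), α.realize ![p.realize ![x, y, y], y] = x) :
    IsCongruenceHyperextensible (Pt Y) where
  hasFiniteLimits := inferInstance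
  hasZeroObject := ⟨_, isZero_pt Y⟩
  hyperextensible := by
    intro W X Z f g s t hst T h U x x' hf hT
    refine T.rel_of_elemRel (ptUnderlying V Y) fun k => ?_
    have htg (a) : (ptUnderlying V Y).map g ((ptUnderlying V Y).map t a) = a := by
      rw [← Functor.map_comp_apply, hst.section_right, Functor.map_id_apply]
    -- The parallelogram has vertices `tgx`, `tgx'`, `x`, `x'`: its `S`-sides come from `gt = 1`,
    -- its `R`-sides from `ft = 0` and `fx = fx'`.
    refine shifting_of_terms (A := W.right.left) p α (hp _) (hα _)
      (R := fun a b => (ptUnderlying V Y).map f a = (ptUnderlying V Y).map f b)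
      (S := fun a b => (ptUnderlying V Y).map g a = (ptUnderlying V Y).map g b)
      ⟨fun _ => rfl, Eq.symm, Eq.trans⟩ (T.elemRel_equivalence (ptUnderlying V Y))
      (fun _ => rfl) (compatible_ker f.right.left) (compatible_ker g.right.left)
      (compatible_range T.d₀.right.left T.d₁.right.left) ?_
      (x := (ptUnderlying V Y).map (x ≫ g ≫ t) k) (x' := (ptUnderlying V Y).map (x' ≫ g ≫ t) k)
      ?_ ?_ ?_ ?_ (hT.elemRel _ k)
    · intro a b ha hb
      obtain ⟨P, q, q', hq, hq', hex, -⟩ := exists_joint_pullback (ptUnderlying V Y) f g f g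
      obtain ⟨m, rfl, rfl⟩ := hex a b ha hb
      exact (h q q' hq hq').elemRel _ m
    · simp only [Functor.map_comp_apply, htg]
    · simp only [Functor.map_comp_apply, htg]
    · simp only [Functor.map_comp_apply]
      rw [← Functor.map_comp_apply _ t f, ← Functor.map_comp_apply _ t f]
      refine map_eq_of_isZeroMor hst.right_punctual ?_
      simp only [ptProj_map]
    · rw [← Functor.map_comp_apply, ← Functor.map_comp_apply, hf]

end Fibre

end Variety

end GummVar

/-! ### The four conclusions, with the Hex-algebras on pointed fibres. -/

theorem mainTheorem8 (L : FirstOrder.Language.{u, u'}) [L.IsAlgebraic] (V : GummVar.Variety L)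
    (p : L.Term (Fin 3)) (α : L.Term (Fin 2))
    (hp : ∀ (A : GummVar.Variety.Alg.{u, u', w} V) (x y : A),
      p.realize ![x, y, y] = p.realize ![y, y, x])
    (hp' : ∀ (A : GummVar.Variety.Alg.{u, u', w} V) (x : A), p.realize ![x, x, x] = x)
    (hα : ∀ (A : GummVar.Variety.Alg.{u, u', w} V) (x y : A),
      α.realize ![p.realize ![x, y, y], y] = x) :
    GummVar.Variety.IsCongruenceModular.{u, u', w} V ∧
    (∀ (X Y : GummVar.Variety.Alg.{u, u', w} V) (f : L.Hom X Y) (s : L.Hom Y X),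
      (∀ y, f (s y) = y) → ∀ y : Y, ∃ H : GummVar.HexAlgebra {a : X // f a = y},
        (H.zero : X) = s y ∧
        (∀ a b, (H.circ a b : X) = p.realize ![(a : X), s y, (b : X)]) ∧
        ∀ a, (H.upsilon a : X) = α.realize ![(a : X), s y]) ∧
    (∀ Y : GummVar.Variety.Alg.{u, u', w} V,
      GummVar.IsCongruenceHyperextensible (GummVar.Pt Y)) ∧
    GummVar.IsGummCategory (GummVar.Variety.Alg.{u, u', w} V) := by
  have hα' : ∀ (A : GummVar.Variety.Alg.{u, u', w} V) (x : A), α.realize ![x, x] = x :=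
    fun A x => by simpa only [hp'] using hα A x x
  refine ⟨fun A => GummVar.Congruence.isModularLattice_of_terms p α (hp A) (hα A), ?_,
    fun Y => GummVar.Variety.isCongruenceHyperextensible_of_terms p α hp hα,
    GummVar.Variety.isGummCategory_of_terms p α hp hα⟩
  intro X Y f s hfs y
  have ker : GummVar.Compatible L fun a b : X => f a = f b :=
    GummVar.Variety.compatible_ker (A := X) (B := Y) f
  refine ⟨
    { zero := ⟨s y, hfs y⟩
      circ := fun a b => ⟨p.realize ![a, s y, b], ?_⟩
      upsilon := fun a => ⟨α.realize ![a, s y], ?_⟩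
      circ_zero_zero := Subtype.ext (hp' X _)
      upsilon_zero := Subtype.ext (hα' X _)
      circ_comm_zero := fun a => Subtype.ext (hp X _ _)
      upsilon_circ_zero := fun a => Subtype.ext (hα X _ _) },
    rfl, fun _ _ => rfl, fun _ => rfl⟩
  -- Modulo the kernel of `f` every argument is `s y`, so idempotence of the term keeps the value in
  -- the fibre.
  · have := ker.realize₃ p (a.2.trans (hfs y).symm) (Eq.refl (f (s y))) (b.2.trans (hfs y).symm)
    rw [hp'] at this
    exact this.trans (hfs y)
  · have := ker.realize₂ α (a.2.trans (hfs y).symm) (Eq.refl (f (s y)))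
    rw [hα'] at this
    exact this.trans (hfs y)
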